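/- Let $N\in\mathbb{N}\cup\{\infty\}$, and let $A$ and $B$ be $N\times N$ matrices with integer entries that are row-finite ($\sum_j |A_{i,j}|<\infty$ and $\sum_j|B_{i,j}|<\infty$ for every $i$) and have no identically zero rows. Suppose that $A_{i,j}\ge 0$ for all $i,j$. Let $E$ be the directed graph with vertices $E^0=\{1,\dots,N\}$ (all positive integers if $N=\infty$) and edges $E^1=\{e_{i,j,n}: 0\le n<A_{i,j}\}$, where $s(e_{i,j,n})=i$ and $r(e_{i,j,n})=j$. Let $E^*$ be the set of finite paths $\alpha_1\cdots\alpha_n$, $r(\alpha_i)=s(\alpha_{i+1})$ (vertices are the paths of length $0$), let $E^\infty$ be the set of infinite paths $x_1x_2\cdots$, and for $\beta\in E^*$ let $Z(\beta)\subseteq E^\infty$ be the set of all infinite paths $\beta y$ with $s(y)=r(\beta)$. For $m\in\mathbb{Z}$ and $e=e_{i,j,n}\in E^1$ put $\kappa_m(e)=e_{i,j,l}$ and $\varphi(m,e)=k$, where $(k,l)$ is the unique pair of integers with $mB_{i,j}+n=kA_{i,j}+l$ and $0\le l<A_{i,j}$; extend $\kappa$ to infinite paths by $\kappa_m(e\,y)=\kappa_m(e)\,\kappa_{\varphi(m,e)}(y)$.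 Let $\mathcal{G}_{A,B}$ be the groupoid of classes $[\alpha,m,\beta;x]$ of quadruples with $\alpha,\beta\in E^*$, $r(\alpha)=r(\beta)$, $m\in\mathbb{Z}$, $x\in Z(\beta)$, for the equivalence relation generated by $$(\alpha,m,\beta;x)\sim(\alpha\kappa_m(\gamma),\varphi(m,\gamma),\beta\gamma;x)\qquad\text{whenever } x=\beta\gamma y,\ \gamma\in E^1,\ y\in E^\infty .$$ Its unit space is $E^\infty$, where $x$ with $s(x)=v$ is identified with $[v,0,v;x]$; the source and range of $[\alpha,m,\beta;\beta y]$ are $\beta y$ and $\alpha\kappa_m(y)$; and product and inverse are $[\alpha,m',\beta;\beta\kappa_m(y)]\cdot[\beta,m,\gamma;\gamma y]=[\alpha,m'+m,\gamma;\gamma y]$ and $[\alpha,m,\beta;\beta y]^{-1}=[\beta,-m,\alpha;\alpha\kappa_m(y)]$. Suppose that $|B_{i,j}|<A_{i,j}$ for all $(i,j)$ with $A_{i,j}\neq0$, and that $E$ is acyclic (no path of positive length has equal source and range). Then $\mathcal{G}_{A,B}$ is principal: for every unit $x\in E^\infty$ the isotropy group $\{g\in\mathcal{G}_{A,B}: s(g)=r(g)=x\}$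 is trivial. -/

import Mathlib

open scoped ENNReal

namespace Katsura

/-- The index set `{1, …, N}` for `N ∈ ℕ ∪ {∞}`. -/
abbrev Index (N : ℕ∞) : Type := {i : ℕ // 1 ≤ i ∧ (i : ℕ∞) ≤ N}

variable {V : Type*}

/-- Every row has finite `ℓ¹`-sum. -/
def RowFinite (A : Matrix V V ℤ) : Prop :=
  ∀ i, ∑' j, ((A i j).natAbs : ℝ≥0∞) < ⊤

/-- The set of positions of nonzero entries. -/
def Omega (A : Matrix V V ℤ) : Set (V × V) := {p | A p.1 p.2 ≠ 0}

/-! ### The graph of a matrix -/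

/-- The edges `e_{i,j,n}`, `0 ≤ n < A i j`, of the graph with vertex set `V`; the edge `e_{i,j,n}`
goes from `i` to `j`. -/
@[ext]
structure Edge (A : Matrix V V ℤ) where
  src : V
  tgt : V
  n : ℤ
  nonneg : 0 ≤ n
  lt : n < A src tgt

variable {A : Matrix V V ℤ}

theorem Edge.pos (e : Edge A) : 0 < A e.src e.tgt := e.nonneg.trans_lt e.lt

/-- `IsPathFromTo v l w`: the consecutive edges in `l` are composable and lead from `v` to `w`. -/
def IsPathFromTo : V → List (Edge A) → V → Prop
  | v, [], w => v = w
  | v, e :: l, w => e.src = v ∧ IsPathFromTo e.tgt l w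

/-- Finite paths, including the paths of length zero, which are the vertices. -/
structure FinPath (A : Matrix V V ℤ) where
  src : V
  edges : List (Edge A)
  tgt : V
  isPath : IsPathFromTo src edges tgt

/-- The length `|α|` of a finite path. -/
def FinPath.length (α : FinPath A) : ℕ := α.edges.length

/-- The path of length zero at `v`. -/
def FinPath.vertex (A : Matrix V V ℤ) (v : V) : FinPath A := ⟨v, [], v, rfl⟩

/-- The graph is acyclic: no path of positive length has equal source and range. -/
def IsAcyclic (A : Matrix V V ℤ) : Prop :=
  ∀ α : FinPath A, 0 < α.length → α.src ≠ α.tgt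

/-- Infinite paths `x = x₁ x₂ ⋯`, indexed from `0`. -/
@[ext]
structure InfPath (A : Matrix V V ℤ) where
  edges : Stream' (Edge A)
  chain : ∀ i, (edges.get i).tgt = (edges.get (i + 1)).src

/-- The source of an infinite path. -/
def InfPath.src (x : InfPath A) : V := (x.edges.get 0).src

/-- The infinite path obtained by deleting the first `k` edges. -/
def InfPath.drop (k : ℕ) (x : InfPath A) : InfPath A where
  edges := x.edges.drop k
  chain i := by
    have := x.chain (i + k)
    rw [Stream'.get_drop, Stream'.get_drop]
    convert this using 3 <;> omega

theorem chain_append {l : List (Edge A)} {v w : V} (hl : IsPathFromTo v l w)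
    {y : Stream' (Edge A)} (hy : ∀ i, (y.get i).tgt = (y.get (i + 1)).src)
    (h : (y.get 0).src = w) :
    ((l ++ₛ y).get 0).src = v ∧
      ∀ i, ((l ++ₛ y).get i).tgt = ((l ++ₛ y).get (i + 1)).src := by
  induction l generalizing v with
  | nil => cases hl; exact ⟨h, hy⟩
  | cons e l ih =>
    obtain ⟨h1, h2⟩ := hl
    obtain ⟨h3, h4⟩ := ih h2
    refine ⟨h1, fun i => ?_⟩
    cases i with
    | zero => exact h3.symm
    | succ i => exact h4 i

/-- The concatenation `α y`, where the source of `y` is the range of `α`. -/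
def FinPath.append (α : FinPath A) (y : InfPath A) (h : y.src = α.tgt) : InfPath A where
  edges := α.edges ++ₛ y.edges
  chain := (chain_append α.isPath y.chain h).2

/-- The cylinder set `Z(α)` of infinite paths `α y`. -/
def FinPath.cyl (α : FinPath A) : Set (InfPath A) :=
  {x | ∃ (y : InfPath A) (h : y.src = α.tgt), x = α.append y h}

/-- The path `α e` for an edge `e` starting at the range of `α`. -/
def FinPath.snoc (α : FinPath A) (e : Edge A) (h : e.src = α.tgt) : FinPath A where
  src := α.src
  edges := α.edges ++ [e]
  tgt := e.tgt
  isPath := by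
    have key : ∀ (l : List (Edge A)) (v : V), IsPathFromTo v l α.tgt →
        IsPathFromTo v (l ++ [e]) e.tgt := by
      intro l
      induction l with
      | nil => intro v hv; exact ⟨h.trans hv.symm, rfl⟩
      | cons a l ih => intro v hv; exact ⟨hv.1, ih _ hv.2⟩
    exact key _ _ α.isPath

/-! ### The action `κ` of `ℤ` and the cocycle `φ` -/

variable (B : Matrix V V ℤ)

/-- `κ_m(e_{i,j,n}) = e_{i,j,l}` where `m B_{i,j} + n = k A_{i,j} + l` and `0 ≤ l < A_{i,j}`. -/
def kappa (m : ℤ) (e : Edge A) : Edge A where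
  src := e.src
  tgt := e.tgt
  n := (m * B e.src e.tgt + e.n) % A e.src e.tgt
  nonneg := Int.emod_nonneg _ e.pos.ne'
  lt := Int.emod_lt_of_pos _ e.pos

/-- `φ(m, e_{i,j,n}) = k` where `m B_{i,j} + n = k A_{i,j} + l` and `0 ≤ l < A_{i,j}`. -/
def phi (m : ℤ) (e : Edge A) : ℤ := (m * B e.src e.tgt + e.n) / A e.src e.tgt

/-- `(φ(m, e), index of κ_m(e))` is the unique pair `(k, l)` in the division with remainder. -/
theorem kappa_phi_iff (m : ℤ) (e : Edge A) (k l : ℤ) :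
    (m * B e.src e.tgt + e.n = k * A e.src e.tgt + l ∧ 0 ≤ l ∧ l < A e.src e.tgt) ↔
      phi B m e = k ∧ (kappa B m e).n = l := by
  have := Int.ediv_emod_unique (a := m * B e.src e.tgt + e.n) (r := l) (q := k) e.pos
  simp only [phi, kappa]
  rw [this]
  constructor
  · rintro ⟨h, h1, h2⟩; exact ⟨by rw [h]; ring, h1, h2⟩
  · rintro ⟨h, h1, h2⟩; exact ⟨by rw [← h]; ring, h1, h2⟩

theorem kappa_phi_spec (m : ℤ) (e : Edge A) :
    m * B e.src e.tgt + e.n = phi B m e * A e.src e.tgt + (kappa B m e).n :=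
  ((kappa_phi_iff B m e _ _).2 ⟨rfl, rfl⟩).1

theorem kappa_phi_add (m₁ m₂ : ℤ) (e : Edge A) :
    phi B (m₁ + m₂) e = phi B m₁ (kappa B m₂ e) + phi B m₂ e ∧
      kappa B (m₁ + m₂) e = kappa B m₁ (kappa B m₂ e) := by
  have h1 := kappa_phi_spec B m₂ e
  have h2 := kappa_phi_spec B m₁ (kappa B m₂ e)
  have h3 : (kappa B m₂ e).src = e.src := rfl
  have h4 : (kappa B m₂ e).tgt = e.tgt := rfl
  rw [h3, h4] at h2
  have := (kappa_phi_iff B (m₁ + m₂) e (phi B m₁ (kappa B m₂ e) + phi B m₂ e)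
    (kappa B m₁ (kappa B m₂ e)).n).1
    ⟨by linarith, (kappa B m₁ (kappa B m₂ e)).nonneg, (kappa B m₁ (kappa B m₂ e)).lt⟩
  exact ⟨this.1, Edge.ext rfl rfl this.2⟩

theorem kappa_phi_zero (e : Edge A) : phi B 0 e = 0 ∧ kappa B 0 e = e := by
  have := (kappa_phi_iff B 0 e 0 e.n).1 ⟨by ring, e.nonneg, e.lt⟩
  exact ⟨this.1, Edge.ext rfl rfl this.2⟩

/-- `cocycleSeq B m x i = φ(m, x₁ ⋯ xᵢ)`, where `φ(m, α'α'') = φ(φ(m, α'), α'')`. -/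
def cocycleSeq (m : ℤ) (x : Stream' (Edge A)) : ℕ → ℤ
  | 0 => m
  | i + 1 => phi B (cocycleSeq m x i) (x.get i)

/-- The action extended to infinite paths by `κ_m(α'α'') = κ_m(α') κ_{φ(m, α')}(α'')`: the `i`-th
edge of `κ_m(x)` is the image of the `i`-th edge of `x` under `κ_{φ(m, x₁ ⋯ x_{i-1})}`. -/
def kappaInf (m : ℤ) (x : InfPath A) : InfPath A where
  edges := fun i => kappa B (cocycleSeq B m x.edges i) (x.edges.get i)
  chain := x.chain

theorem kappaInf_get (m : ℤ) (x : InfPath A) (i : ℕ) :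
    (kappaInf B m x).edges.get i = kappa B (cocycleSeq B m x.edges i) (x.edges.get i) := rfl

/-! ### Quadruples and their classes -/

/-- The quadruples `(α, m, β; x)` with `r(α) = r(β)` and `x ∈ Z(β)`. -/
structure Quad (A B : Matrix V V ℤ) where
  α : FinPath A
  m : ℤ
  β : FinPath A
  x : InfPath A
  tgt_eq : α.tgt = β.tgt
  mem : x ∈ β.cyl

variable {B}

theorem FinPath.drop_of_mem {β : FinPath A} {x : InfPath A} (h : x ∈ β.cyl) :
    (x.drop β.length).src = β.tgt ∧ β.edges ++ₛ (x.drop β.length).edges = x.edges := by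
  obtain ⟨y, hy, rfl⟩ := h
  have : ((β.append y hy).drop β.length) = y := by
    ext1
    exact Stream'.drop_append_stream _ _
  rw [this]
  exact ⟨hy, rfl⟩

namespace Quad

/-- The infinite path `y` with `x = β y`. -/
def tail (q : Quad A B) : InfPath A := q.x.drop q.β.length

theorem tail_src (q : Quad A B) : q.tail.src = q.β.tgt := (FinPath.drop_of_mem q.mem).1

/-- The edge `γ` with `x = β γ y`. -/
def next (q : Quad A B) : Edge A := q.tail.edges.get 0

theorem next_src (q : Quad A B) : q.next.src = q.β.tgt := q.tail_src

/-- The quadruple `(α κ_m(γ), φ(m, γ), β γ; x)`, where `γ` is the edge with `x = β γ y`. -/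
def extend (q : Quad A B) : Quad A B where
  α := q.α.snoc (kappa B q.m q.next) (q.next_src.trans q.tgt_eq.symm)
  m := phi B q.m q.next
  β := q.β.snoc q.next q.next_src
  x := q.x
  tgt_eq := rfl
  mem := by
    refine ⟨q.tail.drop 1, (q.tail.chain 0).symm, ?_⟩
    ext1
    have h := (FinPath.drop_of_mem q.mem).2
    change q.x.edges = (q.β.edges ++ [q.next]) ++ₛ q.tail.edges.drop 1
    rw [Stream'.append_append_stream]
    have h2 : [q.next] ++ₛ q.tail.edges.drop 1 = q.tail.edges := by
      change Stream'.cons q.tail.edges.head q.tail.edges.tail = _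
      exact Stream'.eta _
    rw [h2]
    exact h.symm

/-- The relation that generates the equivalence of quadruples. -/
def Step (p q : Quad A B) : Prop := q = p.extend

/-- `α κ_m(y)`, where `x = β y`. -/
def range (q : Quad A B) : InfPath A :=
  q.α.append (kappaInf B q.m q.tail) (q.tail_src.trans q.tgt_eq.symm)

end Quad

/-- The set of classes `[α, m, β; x]` for the equivalence relation generated by `Quad.Step`. -/
def Germ (A B : Matrix V V ℤ) : Type _ := Quot (Quad.Step (A := A) (B := B))

/-- The class `[α, m, β; x]`. -/
def Germ.mk (q : Quad A B) : Germ A B := Quot.mk _ q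

theorem FinPath.ext_of {α β : FinPath A} (h : α.src = β.src) (h' : α.edges = β.edges) :
    α = β := by
  obtain ⟨v, l, w, hp⟩ := α
  obtain ⟨v', l', w', hp'⟩ := β
  simp only at h h'
  subst h h'
  have key : ∀ (l : List (Edge A)) (v : V), IsPathFromTo v l w → IsPathFromTo v l w' → w = w' := by
    intro l
    induction l with
    | nil => intro v h1 h2; exact h1.symm.trans h2
    | cons a l ih => intro v h1 h2; exact ih _ h1.2 h2.2
  cases key _ _ hp hp'
  rfl

theorem FinPath.src_of_mem {α : FinPath A} {x : InfPath A} (h : x ∈ α.cyl) : x.src = α.src := by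
  obtain ⟨y, hy, rfl⟩ := h
  exact (chain_append α.isPath y.chain hy).1

theorem FinPath.eq_of_mem {α β : FinPath A} {x : InfPath A} (hα : x ∈ α.cyl) (hβ : x ∈ β.cyl)
    (h : α.length = β.length) : α = β := by
  refine FinPath.ext_of ((src_of_mem hα).symm.trans (src_of_mem hβ)) ?_
  have h1 := (drop_of_mem hα).2
  have h2 := (drop_of_mem hβ).2
  rw [← h, ← h1] at h2
  exact (Stream'.append_left_injective _ _ _ _ h2 h.symm).symm

theorem FinPath.append_mem (α : FinPath A) (y : InfPath A) (h : y.src = α.tgt) :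
    α.append y h ∈ α.cyl := ⟨y, h, rfl⟩

theorem FinPath.drop_append (α : FinPath A) (y : InfPath A) (h : y.src = α.tgt) :
    (α.append y h).drop α.length = y := by
  ext1
  exact Stream'.drop_append_stream _ _

theorem cocycleSeq_succ (m : ℤ) (x : Stream' (Edge A)) (i : ℕ) :
    cocycleSeq B m x (i + 1) = cocycleSeq B (phi B m (x.get 0)) (x.drop 1) i := by
  induction i with
  | zero => rfl
  | succ i ih => rw [cocycleSeq, ih, cocycleSeq]; rfl

theorem kappaInf_drop (m : ℤ) (x : InfPath A) :
    (kappaInf B m x).drop 1 = kappaInf B (phi B m (x.edges.get 0)) (x.drop 1) := by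
  ext1
  refine Stream'.ext fun i => ?_
  change kappa B (cocycleSeq B m x.edges (i + 1)) (x.edges.get (i + 1)) = _
  rw [cocycleSeq_succ]
  rfl

theorem kappaInf_add (m₁ m₂ : ℤ) (x : InfPath A) :
    kappaInf B (m₁ + m₂) x = kappaInf B m₁ (kappaInf B m₂ x) := by
  have h : ∀ i, cocycleSeq B (m₁ + m₂) x.edges i =
      cocycleSeq B m₁ (kappaInf B m₂ x).edges i + cocycleSeq B m₂ x.edges i := by
    intro i
    induction i with
    | zero => rfl
    | succ i ih =>
      rw [cocycleSeq, ih, (kappa_phi_add B _ _ _).1]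
      rfl
  ext1
  refine Stream'.ext fun i => ?_
  rw [kappaInf_get, h, (kappa_phi_add B _ _ _).2]
  rfl

theorem kappaInf_zero (x : InfPath A) : kappaInf B 0 x = x := by
  have h : ∀ i, cocycleSeq B 0 x.edges i = 0 := by
    intro i
    induction i with
    | zero => rfl
    | succ i ih => rw [cocycleSeq, ih, (kappa_phi_zero B _).1]
  ext1
  refine Stream'.ext fun i => ?_
  rw [kappaInf_get, h, (kappa_phi_zero B _).2]

namespace Quad

theorem ext_of {p q : Quad A B} (h₁ : p.α = q.α) (h₂ : p.m = q.m) (h₃ : p.β = q.β)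
    (h₄ : p.x = q.x) : p = q := by
  cases p; cases q; simp only at h₁ h₂ h₃ h₄; subst h₁ h₂ h₃ h₄; rfl

theorem length_α_extend (q : Quad A B) : q.extend.α.length = q.α.length + 1 := by
  simp [extend, FinPath.snoc, FinPath.length]

theorem length_β_extend (q : Quad A B) : q.extend.β.length = q.β.length + 1 := by
  simp [extend, FinPath.snoc, FinPath.length]

theorem tail_extend (q : Quad A B) : q.extend.tail = q.tail.drop 1 := by
  unfold tail
  rw [length_β_extend]
  ext1
  change Stream'.drop _ q.x.edges = Stream'.drop _ (Stream'.drop _ q.x.edges)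
  rw [Stream'.drop_drop, add_comm]

theorem range_extend (q : Quad A B) : q.extend.range = q.range := by
  ext1
  change (q.α.edges ++ [kappa B q.m q.next]) ++ₛ (kappaInf B q.extend.m q.extend.tail).edges =
    q.α.edges ++ₛ (kappaInf B q.m q.tail).edges
  rw [Stream'.append_append_stream, tail_extend]
  congr 1
  have h : kappaInf B q.extend.m (q.tail.drop 1) = (kappaInf B q.m q.tail).drop 1 :=
    (kappaInf_drop _ _).symm
  rw [h]
  exact Stream'.eta (kappaInf B q.m q.tail).edges

theorem range_mem (q : Quad A B) : q.range ∈ q.α.cyl := FinPath.append_mem _ _ _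

/-- The unit `[v, 0, v; x]`, where `v` is the source of `x`. -/
def unit (B : Matrix V V ℤ) (x : InfPath A) : Quad A B where
  α := FinPath.vertex A x.src
  m := 0
  β := FinPath.vertex A x.src
  x := x
  tgt_eq := rfl
  mem := ⟨x, rfl, rfl⟩

theorem range_unit (x : InfPath A) : (unit B x).range = x := by
  have h : (unit B x).tail = x := rfl
  ext1
  change (kappaInf B 0 (unit B x).tail).edges = _
  rw [h, kappaInf_zero]

/-- The inverse `(β, -m, α; α κ_m(y))`, where `x = β y`. -/
def inv (q : Quad A B) : Quad A B where
  α := q.β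
  m := -q.m
  β := q.α
  x := q.range
  tgt_eq := q.tgt_eq.symm
  mem := q.range_mem

theorem tail_inv (q : Quad A B) : q.inv.tail = kappaInf B q.m q.tail :=
  FinPath.drop_append q.α (kappaInf B q.m q.tail) (q.tail_src.trans q.tgt_eq.symm)

theorem range_inv (q : Quad A B) : q.inv.range = q.x := by
  ext1
  change q.β.edges ++ₛ (kappaInf B (-q.m) q.inv.tail).edges = _
  rw [tail_inv, ← kappaInf_add, neg_add_cancel, kappaInf_zero]
  exact (FinPath.drop_of_mem q.mem).2

theorem extend_inv (q : Quad A B) : q.extend.inv = q.inv.extend := by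
  have hn : q.inv.next = kappa B q.m q.next := by
    unfold next; rw [tail_inv]; rfl
  have h := kappa_phi_add B (-q.m) q.m q.next
  rw [neg_add_cancel, (kappa_phi_zero B q.next).1, (kappa_phi_zero B q.next).2] at h
  refine ext_of (FinPath.ext_of rfl ?_) ?_ (FinPath.ext_of rfl ?_) q.range_extend
  · change q.β.edges ++ [q.next] = q.β.edges ++ [kappa B (-q.m) q.inv.next]
    rw [hn, ← h.2]
  · change - phi B q.m q.next = phi B (-q.m) q.inv.next
    rw [hn]; linarith [h.1]
  · change q.α.edges ++ [kappa B q.m q.next] = q.α.edges ++ [q.inv.next]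
    rw [hn]

/-- The product `(α, m', β; β κ_m(y)) · (β, m, γ; γ y) = (α, m' + m, γ; γ y)`. -/
def mul (p q : Quad A B) (h : p.β = q.α) : Quad A B where
  α := p.α
  m := p.m + q.m
  β := q.β
  x := q.x
  tgt_eq := p.tgt_eq.trans ((congrArg FinPath.tgt h).trans q.tgt_eq)
  mem := q.mem

theorem tail_of_comp {p q : Quad A B} (h : p.β = q.α) (hx : p.x = q.range) :
    p.tail = kappaInf B q.m q.tail := by
  unfold tail
  rw [hx, h]
  exact FinPath.drop_append _ _ _

theorem range_mul {p q : Quad A B} (h : p.β = q.α) (hx : p.x = q.range) :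
    (p.mul q h).range = p.range := by
  ext1
  change p.α.edges ++ₛ (kappaInf B (p.m + q.m) q.tail).edges =
    p.α.edges ++ₛ (kappaInf B p.m p.tail).edges
  rw [tail_of_comp h hx, kappaInf_add]

theorem extend_align {p q : Quad A B} (hx : p.x = q.range)
    (h : p.β.length = q.α.length) : p.β = q.α :=
  FinPath.eq_of_mem (x := p.x) p.mem (hx ▸ q.range_mem) h

theorem extend_mul {p q : Quad A B} (h : p.β = q.α) (hx : p.x = q.range)
    (h' : p.extend.β = q.extend.α) :
    p.extend.mul q.extend h' = (p.mul q h).extend := by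
  have hn : p.next = kappa B q.m q.next := by
    unfold next; rw [tail_of_comp h hx]; rfl
  have hk := kappa_phi_add B p.m q.m q.next
  refine ext_of (FinPath.ext_of rfl ?_) ?_ (FinPath.ext_of rfl rfl) rfl
  · change p.α.edges ++ [kappa B p.m p.next] = p.α.edges ++ [kappa B (p.m + q.m) q.next]
    rw [hn, hk.2]
  · change phi B p.m p.next + phi B q.m q.next = phi B (p.m + q.m) q.next
    rw [hn, hk.1]

/-! Iterated extensions. -/

theorem length_α_iter (q : Quad A B) (k : ℕ) :
    (extend^[k] q).α.length = q.α.length + k := by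
  induction k with
  | zero => rfl
  | succ k ih => rw [Function.iterate_succ_apply', length_α_extend, ih, add_assoc]

theorem length_β_iter (q : Quad A B) (k : ℕ) :
    (extend^[k] q).β.length = q.β.length + k := by
  induction k with
  | zero => rfl
  | succ k ih => rw [Function.iterate_succ_apply', length_β_extend, ih, add_assoc]

theorem range_iter (q : Quad A B) (k : ℕ) : (extend^[k] q).range = q.range := by
  induction k with
  | zero => rfl
  | succ k ih => rw [Function.iterate_succ_apply', range_extend, ih]

theorem x_iter (q : Quad A B) (k : ℕ) : (extend^[k] q).x = q.x := by
  induction k with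
  | zero => rfl
  | succ k ih => rw [Function.iterate_succ_apply', ← ih]; rfl

theorem align_iter {p q : Quad A B} (hx : p.x = q.range) {a b : ℕ}
    (h : p.β.length + a = q.α.length + b) : (extend^[a] p).β = (extend^[b] q).α :=
  extend_align (by rw [x_iter, range_iter, hx]) (by rw [length_β_iter, length_α_iter, h])

end Quad

namespace Germ

theorem mk_extend (q : Quad A B) : mk q.extend = mk q :=
  (Quot.sound (r := Quad.Step) (show Quad.Step q q.extend from rfl)).symm

theorem mk_iter (q : Quad A B) (k : ℕ) : mk (Quad.extend^[k] q) = mk q := by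
  induction k with
  | zero => rfl
  | succ k ih => rw [Function.iterate_succ_apply', mk_extend, ih]

theorem mk_eq_iff {p q : Quad A B} :
    mk p = mk q ↔ ∃ a b, Quad.extend^[a] p = Quad.extend^[b] q := by
  constructor
  · intro h
    replace h := Quot.eqvGen_exact h
    induction h with
    | rel p q h => exact ⟨1, 0, h.symm⟩
    | refl p => exact ⟨0, 0, rfl⟩
    | symm p q _ ih => obtain ⟨a, b, h⟩ := ih; exact ⟨b, a, h.symm⟩
    | trans p q r _ _ ih₁ ih₂ =>
      obtain ⟨a, b, h⟩ := ih₁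
      obtain ⟨c, d, h'⟩ := ih₂
      refine ⟨c + a, b + d, ?_⟩
      rw [Function.iterate_add_apply, h, Function.iterate_add_apply, ← h',
        ← Function.iterate_add_apply, ← Function.iterate_add_apply, add_comm]
  · rintro ⟨a, b, h⟩
    rw [← mk_iter p a, h, mk_iter]

/-- `s([α, m, β; x]) = x`. -/
def source : Germ A B → InfPath A := Quot.lift Quad.x fun p q h => by rw [show q = _ from h]; rfl

/-- `r([α, m, β; x]) = α κ_m(y)`, where `x = β y`. -/
def range : Germ A B → InfPath A :=
  Quot.lift Quad.range fun p q h => by rw [show q = _ from h, Quad.range_extend]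

/-- `[α, m, β; x]⁻¹ = [β, -m, α; α κ_m(y)]`, where `x = β y`. -/
def inv : Germ A B → Germ A B :=
  Quot.lift (fun q => mk q.inv) fun p q h => by
    rw [show q = _ from h, Quad.extend_inv, mk_extend]

/-- The unit `[v, 0, v; x]`. -/
def unit (B : Matrix V V ℤ) (x : InfPath A) : Germ A B := mk (Quad.unit B x)

/-- Composable classes have representatives of the form `(α, m', β; β κ_m(y))` and
`(β, m, γ; γ y)`. -/
theorem exists_align (g h : Germ A B) (hgh : g.source = h.range) :
    ∃ pq : Quad A B × Quad A B, mk pq.1 = g ∧ mk pq.2 = h ∧ pq.1.β = pq.2.α := by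
  induction g using Quot.inductionOn with | _ p
  induction h using Quot.inductionOn with | _ q
  exact ⟨(Quad.extend^[q.α.length] p, Quad.extend^[p.β.length] q), mk_iter _ _, mk_iter _ _,
    Quad.align_iter hgh (add_comm _ _)⟩

/-- The product of composable classes,
`[α, m', β; β κ_m(y)] · [β, m, γ; γ y] = [α, m' + m, γ; γ y]`; it does not depend on the chosen
representatives of this form, by `mul_mk`. -/
noncomputable def mul (g h : Germ A B) (hgh : g.source = h.range) : Germ A B :=
  mk ((exists_align g h hgh).choose.1.mul (exists_align g h hgh).choose.2
    (exists_align g h hgh).choose_spec.2.2)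

theorem mk_mul_iter {p q : Quad A B} (h : p.β = q.α) (hx : p.x = q.range) (k : ℕ)
    (h' : (Quad.extend^[k] p).β = (Quad.extend^[k] q).α) :
    mk ((Quad.extend^[k] p).mul (Quad.extend^[k] q) h') = mk (p.mul q h) := by
  induction k generalizing p q with
  | zero => rfl
  | succ k ih =>
    have hx' : p.extend.x = q.extend.range := hx.trans q.range_extend.symm
    have hl : p.extend.β = q.extend.α :=
      Quad.extend_align hx' (by rw [Quad.length_α_extend, Quad.length_β_extend, h])
    have := ih hl hx' h'
    rw [Quad.extend_mul h hx hl, mk_extend] at this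
    exact this

theorem mk_mul_congr {p q p' q' : Quad A B} (h : p.β = q.α) (hx : p.x = q.range)
    (h' : p'.β = q'.α) (hx' : p'.x = q'.range) (hp : mk p = mk p') (hq : mk q = mk q') :
    mk (p.mul q h) = mk (p'.mul q' h') := by
  obtain ⟨a, b, hab⟩ := mk_eq_iff.1 hp
  obtain ⟨c, d, hcd⟩ := mk_eq_iff.1 hq
  have e1 := congrArg (fun r => r.β.length) hab
  have e2 := congrArg (fun r => r.α.length) hcd
  simp only [Quad.length_α_iter, Quad.length_β_iter] at e1 e2
  have e3 := congrArg FinPath.length h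
  have e4 := congrArg FinPath.length h'
  have e5 : d + a = c + b := by omega
  have hp' : Quad.extend^[c + a] p = Quad.extend^[c + b] p' := by
    rw [Function.iterate_add_apply, hab, ← Function.iterate_add_apply]
  have hq' : Quad.extend^[c + a] q = Quad.extend^[c + b] q' := by
    rw [add_comm, Function.iterate_add_apply, hcd, ← Function.iterate_add_apply, add_comm, e5]
  have l1 : (Quad.extend^[c + a] p).β = (Quad.extend^[c + a] q).α :=
    Quad.align_iter hx (by rw [e3])
  have l2 : (Quad.extend^[c + b] p').β = (Quad.extend^[c + b] q').α :=
    Quad.align_iter hx' (by rw [e4])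
  rw [← mk_mul_iter h hx (c + a) l1, ← mk_mul_iter h' hx' (c + b) l2]
  congr 1
  congr 1

theorem mul_mk (p q : Quad A B) (h : p.β = q.α) (hx : p.x = q.range) :
    mul (mk p) (mk q) hx = mk (p.mul q h) := by
  have hs := (exists_align (mk p) (mk q) hx).choose_spec
  refine mk_mul_congr _ ?_ h hx hs.1 hs.2.1
  have h1 := congrArg source hs.1
  have h2 := congrArg range hs.2.1
  exact h1.trans (hx.trans h2.symm)

/-- Induction on composable pairs. -/
theorem ind₂ {P : (g h : Germ A B) → g.source = h.range → Prop}
    (H : ∀ (p q : Quad A B), p.β = q.α → ∀ hx : p.x = q.range, P (mk p) (mk q) hx)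
    (g h : Germ A B) (hgh : g.source = h.range) : P g h hgh := by
  obtain ⟨⟨p, q⟩, rfl, rfl, h⟩ := exists_align g h hgh
  exact H p q h hgh

theorem source_mul (g h : Germ A B) (hgh : g.source = h.range) :
    (mul g h hgh).source = h.source := by
  induction g, h, hgh using ind₂ with | _ p q h hx
  rw [mul_mk p q h hx]
  rfl

theorem range_mul (g h : Germ A B) (hgh : g.source = h.range) :
    (mul g h hgh).range = g.range := by
  induction g, h, hgh using ind₂ with | _ p q h hx
  rw [mul_mk p q h hx]
  exact Quad.range_mul h hx

theorem source_unit (x : InfPath A) : (unit B x).source = x := rfl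

theorem range_unit (x : InfPath A) : (unit B x).range = x := Quad.range_unit x

theorem source_inv (g : Germ A B) : g.inv.source = g.range := by
  induction g using Quot.inductionOn with | _ p
  rfl

theorem range_inv (g : Germ A B) : g.inv.range = g.source := by
  induction g using Quot.inductionOn with | _ p
  exact Quad.range_inv p

/-- The classes `[β, 0, β; x]` are units. -/
theorem mk_eq_unit (q : Quad A B) (h : q.α = q.β) (hm : q.m = 0) : mk q = unit B q.x := by
  refine mk_eq_iff.2 ⟨0, q.β.length, ?_⟩
  have key : ∀ k, (Quad.extend^[k] (Quad.unit B q.x)).m = 0 ∧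
      (Quad.extend^[k] (Quad.unit B q.x)).α = (Quad.extend^[k] (Quad.unit B q.x)).β := by
    intro k
    induction k with
    | zero => exact ⟨rfl, rfl⟩
    | succ k ih =>
      rw [Function.iterate_succ_apply']
      generalize Quad.extend^[k] (Quad.unit B q.x) = p at ih
      obtain ⟨ih1, ih2⟩ := ih
      have h0 := kappa_phi_zero B p.next
      rw [← ih1] at h0
      refine ⟨h0.1.trans ih1, FinPath.ext_of (show p.α.src = p.β.src by rw [ih2]) ?_⟩
      change p.α.edges ++ [kappa B p.m p.next] = p.β.edges ++ [p.next]
      rw [h0.2, ih2]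
  have hβ : q.β = (Quad.extend^[q.β.length] (Quad.unit B q.x)).β := by
    refine FinPath.eq_of_mem (x := q.x) q.mem ?_ ?_
    · have := (Quad.extend^[q.β.length] (Quad.unit B q.x)).mem
      rwa [Quad.x_iter] at this
    · rw [Quad.length_β_iter]
      simp [Quad.unit, FinPath.vertex, FinPath.length]
  exact Quad.ext_of (h.trans (hβ.trans (key _).2.symm)) (hm.trans (key _).1.symm) hβ
    (Quad.x_iter (Quad.unit B q.x) q.β.length).symm

theorem mul_inv (g : Germ A B) (h : g.source = g.inv.range) :
    mul g g.inv h = unit B g.range := by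
  induction g using Quot.inductionOn with | _ p
  refine (mul_mk p p.inv rfl h).trans (mk_eq_unit _ rfl (add_neg_cancel _))

theorem inv_mul (g : Germ A B) (h : g.inv.source = g.range) :
    mul g.inv g h = unit B g.source := by
  induction g using Quot.inductionOn with | _ p
  exact (mul_mk p.inv p rfl h).trans (mk_eq_unit _ rfl (neg_add_cancel _))

theorem mul_assoc (g h k : Germ A B) (h₁ : g.source = h.range) (h₂ : h.source = k.range)
    (h₃ : (mul g h h₁).source = k.range) (h₄ : g.source = (mul h k h₂).range) :
    mul (mul g h h₁) k h₃ = mul g (mul h k h₂) h₄ := by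
  induction g using Quot.inductionOn with | _ p
  induction h using Quot.inductionOn with | _ q
  induction k using Quot.inductionOn with | _ r
  -- representatives with `p.β = q.α` and `q.β = r.α`
  obtain ⟨p', q', r', ep, eq, er, e1, e2⟩ : ∃ p' q' r' : Quad A B, mk p' = mk p ∧ mk q' = mk q ∧
      mk r' = mk r ∧ p'.β = q'.α ∧ q'.β = r'.α := by
    refine ⟨Quad.extend^[q.α.length + r.α.length] p,
      Quad.extend^[p.β.length + r.α.length] q, Quad.extend^[p.β.length + q.β.length] r,
      mk_iter _ _, mk_iter _ _, mk_iter _ _, Quad.align_iter h₁ (by omega),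
      Quad.align_iter h₂ (by omega)⟩
  change mul (mul (mk p) (mk q) h₁) (mk r) h₃ = mul (mk p) (mul (mk q) (mk r) h₂) h₄
  have x1 : p'.x = q'.range := (congrArg source ep).trans (h₁.trans (congrArg range eq).symm)
  have x2 : q'.x = r'.range := (congrArg source eq).trans (h₂.trans (congrArg range er).symm)
  have m1 : mul (mk p) (mk q) h₁ = mk (p'.mul q' e1) := by
    rw [← mul_mk p' q' e1 x1]; congr 1 <;> exact Eq.symm ‹_›
  have m2 : mul (mk q) (mk r) h₂ = mk (q'.mul r' e2) := by
    rw [← mul_mk q' r' e2 x2]; congr 1 <;> exact Eq.symm ‹_›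
  have l : mul (mul (mk p) (mk q) h₁) (mk r) h₃ = mk ((p'.mul q' e1).mul r' e2) := by
    rw [← mul_mk (p'.mul q' e1) r' e2 x2]; congr 1; exact er.symm
  have r : mul (mk p) (mul (mk q) (mk r) h₂) h₄ = mk (p'.mul (q'.mul r' e2) e1) := by
    rw [← mul_mk p' (q'.mul r' e2) e1 (x1.trans (Quad.range_mul e2 x2).symm)]
    congr 1; exact ep.symm
  rw [l, r]
  exact congrArg mk (Quad.ext_of rfl (add_assoc _ _ _) rfl rfl)

theorem mul_unit (g : Germ A B) (x : InfPath A) (hx : g.source = x)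
    (h : g.source = (unit B x).range) : mul g (unit B x) h = g := by
  subst hx
  induction g using Quot.inductionOn with | _ p
  let u : Quad A B := ⟨p.β, 0, p.β, p.x, rfl, p.mem⟩
  have hu : mk u = unit B p.x := mk_eq_unit u rfl rfl
  have hur : p.x = u.range := h.trans (congrArg range hu).symm
  have : mul (mk p) (unit B p.x) h = mk (p.mul u rfl) := by
    rw [← mul_mk p u rfl hur]; congr 1; exact hu.symm
  exact this.trans (congrArg mk (Quad.ext_of rfl (add_zero _) rfl rfl))

theorem unit_mul (g : Germ A B) (x : InfPath A) (hx : g.range = x)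
    (h : (unit B x).source = g.range) : mul (unit B x) g h = g := by
  subst hx
  induction g using Quot.inductionOn with | _ p
  let u : Quad A B := ⟨p.α, 0, p.α, p.range, rfl, p.range_mem⟩
  have hu : mk u = unit B p.range := mk_eq_unit u rfl rfl
  have : mul (unit B p.range) (mk p) h = mk (u.mul p rfl) := by
    rw [← mul_mk u p rfl rfl]; congr 1; exact hu.symm
  exact this.trans (congrArg mk (Quad.ext_of rfl (zero_add _) rfl rfl))

end Germ

/-! ### The groupoid -/

/-- The Katsura--Exel--Pardo groupoid of `A` and `B`, as a category: its objects are the units,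
that is the infinite paths, and its morphisms are the classes `[α, m, β; x]`. -/
@[ext]
structure KEPGroupoid (A B : Matrix V V ℤ) where
  path : InfPath A

/-- A morphism from `x` to `y` is a class with source `x` and range `y`, and `f ≫ g` is the
product `g · f`. -/
noncomputable instance instGroupoid (A B : Matrix V V ℤ) : CategoryTheory.Groupoid (KEPGroupoid A B) where
  Hom x y := {g : Germ A B // g.source = x.path ∧ g.range = y.path}
  id x := ⟨Germ.unit B x.path, Germ.source_unit _, Germ.range_unit _⟩
  comp f g := ⟨Germ.mul g.1 f.1 (g.2.1.trans f.2.2.symm),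
    (Germ.source_mul _ _ _).trans f.2.1, (Germ.range_mul _ _ _).trans g.2.2⟩
  inv f := ⟨f.1.inv, (Germ.source_inv _).trans f.2.2, (Germ.range_inv _).trans f.2.1⟩
  id_comp {x _} f := Subtype.ext
    (Germ.mul_unit f.1 x.path f.2.1 (f.2.1.trans (Germ.range_unit x.path).symm))
  comp_id {_ y} f := Subtype.ext (Germ.unit_mul f.1 y.path f.2.2 f.2.2.symm)
  assoc f g h := Subtype.ext (Germ.mul_assoc h.1 g.1 f.1 (h.2.1.trans g.2.2.symm)
    (g.2.1.trans f.2.2.symm)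
    ((Germ.source_mul _ _ _).trans (g.2.1.trans f.2.2.symm))
    (h.2.1.trans (g.2.2.symm.trans (Germ.range_mul _ _ _).symm))).symm
  inv_comp f := Subtype.ext
    ((Germ.mul_inv f.1 (Germ.range_inv f.1).symm).trans (congrArg _ f.2.2))
  comp_inv f := Subtype.ext
    ((Germ.inv_mul f.1 (Germ.source_inv f.1)).trans (congrArg _ f.2.1))

/-- A groupoid is principal if all its isotropy groups are trivial. -/
def IsPrincipal (G : Type*) [CategoryTheory.Groupoid G] : Prop :=
  ∀ x : G, Subsingleton (x ⟶ x)

end Katsura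

/-! Let `[α, m, β; x]` be an isotropy element, with `x = β y = α κ_m(y)`. Both `α` and `β` are
prefixes of `x` and they end at the same vertex. An infinite path in an acyclic graph never returns
to a vertex, so the two prefixes have equal length and `α = β` (`Quad.α_eq_β_of_range_eq`).

Write `x = β γ y'`. The class is also represented by `(α κ_m(γ), φ(m, γ), β γ; x)`, which has the
same source and range. The same argument gives `α κ_m(γ) = β γ`, so `κ_m` fixes `γ`. The division
with remainder then reads `m B = φ(m, γ) A` at the position of `γ`, and `|B| < A` forces `|φ(m, γ)|
< |m|` unless `m = 0` (`natAbs_phi_lt`). Lengthening the representative thus strictly lowers `|m|`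
until it reaches `0`, and `[β, 0, β; x]` is a unit (`Germ.mk_eq_unit_of_range_eq`). -/

namespace Katsura

/-! ### Infinite paths in an acyclic graph. -/

variable {V : Type*} {A B : Matrix V V ℤ}

/-- A segment of an infinite path is a finite path. -/
theorem InfPath.exists_segment (x : InfPath A) (k i : ℕ) :
    ∃ l : List (Edge A), l.length = k ∧
      IsPathFromTo (x.edges.get i).src l (x.edges.get (i + k)).src := by
  induction k generalizing i with
  | zero => exact ⟨[], rfl, rfl⟩
  | succ k ih =>
    obtain ⟨l, hl, hp⟩ := ih (i + 1)
    refine ⟨x.edges.get i :: l, by simp [hl], rfl, ?_⟩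
    rw [x.chain i, show i + (k + 1) = i + 1 + k by omega]
    exact hp

/-- In an acyclic graph, an infinite path visits no vertex twice. -/
theorem IsAcyclic.injective_src (hA : IsAcyclic A) (x : InfPath A) :
    Function.Injective fun i => (x.edges.get i).src := by
  -- If these vertices agreed, the segment of `k` edges starting at position `i` would be a closed
  -- path of positive length.
  have key : ∀ i k, 0 < k → (x.edges.get i).src ≠ (x.edges.get (i + k)).src := by
    intro i k hk
    obtain ⟨l, rfl, hp⟩ := x.exists_segment k i
    exact hA ⟨_, l, _, hp⟩ hk
  intro i j hij
  rcases lt_trichotomy i j with h | h | h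
  · refine absurd hij ?_
    have := key i (j - i) (by omega)
    rwa [Nat.add_sub_cancel' h.le] at this
  · exact h
  · refine absurd hij.symm ?_
    have := key j (i - j) (by omega)
    rwa [Nat.add_sub_cancel' h.le] at this

theorem InfPath.src_drop (x : InfPath A) (k : ℕ) : (x.drop k).src = (x.edges.get k).src := by
  change (x.edges.get (0 + k)).src = _
  rw [zero_add]

/-! ### Representatives with equal source and range. -/

namespace Quad

/-- In an acyclic graph, `(α, m, β; x)` has equal source and range only if `α = β`. -/
theorem α_eq_β_of_range_eq (hA : IsAcyclic A) (q : Quad A B) (h : q.range = q.x) :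
    q.α = q.β := by
  have hα : q.x ∈ q.α.cyl := h ▸ q.range_mem
  -- Prefixes of one path are determined by their length. The lengths of `α` and `β` are positions
  -- on `x` whose vertices are the ranges of `α` and `β`, so injectivity of the vertex sequence
  -- gives equal lengths.
  refine FinPath.eq_of_mem hα q.mem (hA.injective_src q.x ?_)
  have h1 := (FinPath.drop_of_mem hα).1
  have h2 := (FinPath.drop_of_mem q.mem).1
  rw [InfPath.src_drop] at h1 h2
  exact h1.trans (q.tgt_eq.trans h2.symm)

end Quad

/-! ### Contraction of the cocycle on fixed edges. -/

/-- If `κ_m` fixes the edge `e` and `m ≠ 0`, then `|φ(m, e)| < |m|`. -/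
theorem natAbs_phi_lt {m : ℤ} {e : Edge A} (hlt : |B e.src e.tgt| < A e.src e.tgt) (hm : m ≠ 0)
    (he : kappa B m e = e) : (phi B m e).natAbs < m.natAbs := by
  have h := kappa_phi_spec B m e
  rw [he] at h
  -- Since `e` is fixed, its index is both the summand on the left and the remainder on the right,
  -- and cancels.
  have h' : phi B m e * A e.src e.tgt = m * B e.src e.tgt := by linarith
  have habs : |phi B m e| * A e.src e.tgt = |m| * |B e.src e.tgt| := by
    rw [← abs_mul, ← h', abs_mul, abs_of_pos e.pos]
  have hlt' : |phi B m e| * A e.src e.tgt < |m| * A e.src e.tgt :=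
    habs ▸ mul_lt_mul_of_pos_left hlt (abs_pos.2 hm)
  have := lt_of_mul_lt_mul_right hlt' e.pos.le
  rw [Int.abs_eq_natAbs, Int.abs_eq_natAbs] at this
  exact_mod_cast this

/-! ### Descent on `|m|` and conclusion. -/

namespace Germ

/-- If the graph is acyclic and `|B i j| < A i j` wherever `A i j ≠ 0`, then every class with equal
source and range is a unit. -/
theorem mk_eq_unit_of_range_eq (hA : IsAcyclic A)
    (hlt : ∀ i j, (i, j) ∈ Omega A → |B i j| < A i j) (q : Quad A B) (h : q.range = q.x) :
    mk q = unit B q.x := by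
  -- The representative must vary in the induction: passing to `q.extend` changes `α`, `β` and `m`,
  -- and keeps only `x` and the class.
  induction hn : q.m.natAbs using Nat.strong_induction_on generalizing q with | _ n ih
  subst hn
  have hq := q.α_eq_β_of_range_eq hA h
  by_cases hm : q.m = 0
  · exact mk_eq_unit q hq hm
  have h' : q.extend.range = q.extend.x := q.range_extend.trans h
  have he : kappa B q.m q.next = q.next := by
    -- The extension again has equal source and range, so its two finite paths coincide too;
    -- cancelling the common prefix leaves an equality of last edges.
    have h1 : q.α.edges ++ [kappa B q.m q.next] = q.β.edges ++ [q.next] :=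
      congrArg FinPath.edges (q.extend.α_eq_β_of_range_eq hA h')
    rw [hq] at h1
    simpa using h1
  -- The existence of the edge `q.next` makes the corresponding entry of `A` positive, which puts
  -- its position in `Omega A`.
  have hdec := natAbs_phi_lt (hlt _ _ q.next.pos.ne') hm he
  exact (mk_extend q).symm.trans (ih _ hdec q.extend h' rfl)

/-- Source and range of a class are computed on any representative, so the statement for quadruples
descends to the quotient. -/
theorem eq_unit_of_range_eq_source (hA : IsAcyclic A)
    (hlt : ∀ i j, (i, j) ∈ Omega A → |B i j| < A i j) (g : Germ A B)
    (h : g.range = g.source) : g = unit B g.source := by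
  induction g using Quot.inductionOn with | _ q
  exact mk_eq_unit_of_range_eq hA hlt q h

end Germ

end Katsura

theorem mainTheorem10 (N : ℕ∞)
    (A B : Matrix (Katsura.Index N) (Katsura.Index N) ℤ)
    (hA : Katsura.RowFinite A) (hB : Katsura.RowFinite B)
    (hA0 : ∀ i, ∃ j, A i j ≠ 0) (hB0 : ∀ i, ∃ j, B i j ≠ 0)
    (hnonneg : ∀ i j, 0 ≤ A i j)
    (hlt : ∀ i j, (i, j) ∈ Katsura.Omega A → |B i j| < A i j)
    (hacyclic : Katsura.IsAcyclic A) :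
    Katsura.IsPrincipal (Katsura.KEPGroupoid A B) := by
  intro x
  -- An endomorphism of `x` is a class whose source and range are both `x.path`, so it can only be
  -- the unit there; hence any two of them agree.
  have key : ∀ f : x ⟶ x, f.1 = Katsura.Germ.unit B x.path := fun f =>
    (Katsura.Germ.eq_unit_of_range_eq_source hacyclic hlt f.1 (f.2.2.trans f.2.1.symm)).trans
      (congrArg _ f.2.1)
  exact ⟨fun f g => Subtype.ext ((key f).trans (key g).symm)⟩
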